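/- Let $E$ be a uniformly convex and smooth real Banach space (smooth: $\lim_{s\to 0}(\|a+sb\|-\|a\|)/s$ exists whenever $\|a\|=\|b\|=1$), with normalized duality mapping $J(v)=\{f\in E^* : f(v)=\|v\|^2=\|f\|^2\}$, which is single-valued because $E$ is smooth. Let $C\subset E$ be nonempty, bounded, closed and convex, and let $T:C\to C$ be asymptotically nonexpansive, i.e. there are $k_n\in[1,\infty)$ with $k_n\to1$ and $\|T^na-T^nb\|\le k_n\|a-b\|$ for all $a,b\in C$, $n\ge1$. Put $F(T)=\{z\in C: Tz=z\}$. For $K\subset E$ and $v\in E$ write $P_Kv$ for the unique point of $K$ nearest to $v$, when there is exactly one such point. Let $(t_n)_{n\ge1}$ be a sequence in $(0,1)$ with $t_n\to0$ and let $x\in C$. Put $x_1=x$, $C_0=D_0=C$ and, for $n=1,2,\dots$, $$C_n=\overline{\mathrm{co}}\,\{z\in C_{n-1} : \|z-T^nz\|\le t_n\|x_n-T^nx_n\|\},$$ $$D_n=\{z\in D_{n-1} : \langle x_n-z,\,J(x-x_n)\rangle\ge0\},\qquad x_{n+1}=P_{C_n\cap D_n}x,$$ where $\overline{\mathrm{co}}$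 denotes the closed convex hull. Then the metric projection $P_{F(T)}$ is defined on all of $E$ (in particular $F(T)\ne\emptyset$), the scheme is well defined (for every $n\ge1$ there is exactly one point of $C_n\cap D_n$ nearest to $x$), and $x_n$ converges strongly (in norm) to $P_{F(T)}x$. -/

import Mathlib

open Filter Topology Set

/-- Smoothness of a normed space: the norm has a (two-sided) directional derivative at every unit
vector in every unit direction. -/
def IsSmoothSpace (E : Type*) [NormedAddCommGroup E] [NormedSpace ℝ E] : Prop :=
  ∀ x y : E, ‖x‖ = 1 → ‖y‖ = 1 →
    ∃ l : ℝ, Tendsto (fun s : ℝ => (‖x + s • y‖ - ‖x‖) / s) (𝓝[≠] 0) (𝓝 l)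

/-- The normalized duality mapping `J : E → 2^{E*}`. -/
def dualityMap {E : Type*} [NormedAddCommGroup E] [NormedSpace ℝ E] (x : E) :
    Set (StrongDual ℝ E) :=
  {f | f x = ‖x‖ ^ 2 ∧ ‖f‖ ^ 2 = ‖x‖ ^ 2}

/-- `u` is a point of `K` nearest to `x`, that is, a value at `x` of the metric projection onto
`K`. -/
def IsMetricProj {E : Type*} [NormedAddCommGroup E] (K : Set E) (x u : E) : Prop :=
  u ∈ K ∧ ∀ y ∈ K, ‖u - x‖ ≤ ‖y - x‖

/-- `T` restricts to an asymptotically nonexpansive self-map of `C`. The values of `T` outside `C`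
play no role. -/
def IsAsympNonexpansive {E : Type*} [NormedAddCommGroup E] (C : Set E) (T : E → E) : Prop :=
  MapsTo T C C ∧
    ∃ k : ℕ → ℝ, (∀ n, 1 ≤ k n) ∧ Tendsto k atTop (𝓝 1) ∧
      ∀ n, 1 ≤ n → ∀ x ∈ C, ∀ y ∈ C, ‖T^[n] x - T^[n] y‖ ≤ k n * ‖x - y‖

/-- The set `F(T)` of fixed points of `T : C → C`. -/
def fixedSet {E : Type*} (C : Set E) (T : E → E) : Set E :=
  {z | z ∈ C ∧ T z = z}

/-- The sets `Cs n`, `Ds n` (for `n ≥ 0`) and the points `xs n` (for `n ≥ 1`) are generated by the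
hybrid scheme started at `x`. The value `xs 0` is not used. In a smooth space the duality mapping
is single-valued (it is always nonempty-valued), so that the quantifier over
`f ∈ dualityMap (x - xs (n + 1))` only names the unique element of that set. -/
structure IsHybridScheme {E : Type*} [NormedAddCommGroup E] [NormedSpace ℝ E]
    (C : Set E) (T : E → E) (t : ℕ → ℝ) (x : E)
    (Cs Ds : ℕ → Set E) (xs : ℕ → E) : Prop where
  C_zero : Cs 0 = C
  D_zero : Ds 0 = C
  x_one : xs 1 = x
  C_succ : ∀ n, Cs (n + 1) = closedConvexHull ℝ
    {z | z ∈ Cs n ∧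
      ‖z - T^[n + 1] z‖ ≤ t (n + 1) * ‖xs (n + 1) - T^[n + 1] (xs (n + 1))‖}
  D_succ : ∀ n, Ds (n + 1) =
    {z | z ∈ Ds n ∧ ∀ f ∈ dualityMap (x - xs (n + 1)), 0 ≤ f (xs (n + 1) - z)}
  x_succ : ∀ n, 1 ≤ n → IsMetricProj (Cs n ∩ Ds n) x (xs (n + 1))

/-! The points $x_{n+1}$ are projections of $x$ onto a decreasing sequence of closed convex sets,
all containing $F(T)$. Hence their distances to $x$ increase and stay bounded, and uniform convexity
makes them converge to some $w$ in every $C_n\cap D_n$ that is no farther from $x$ than $P_{F(T)}x$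
(`antitone_isMetricProj_tendsto`). Smoothness serves only to keep $F(T)$ inside $D_n$
(`IsMetricProj.dualityMap_nonneg`).

What remains is $w\in F(T)$. As $C$ is bounded and $t_n\to0$, $w$ lies in closed convex hulls of
ever better approximate fixed points of $T^n$. By `exists_norm_sub_le_of_mem_closedConvexHull`, such
hulls consist of approximate fixed points, uniformly over almost nonexpansive maps. So $T^nw\to w$,
and continuity of $T$ on $C$ gives $Tw=w$. The same argument shows that $F(T)$ is closed and convex;
it is nonempty because the asymptotic center of an orbit is fixed. -/

/-! ### Quantitative uniform convexity and variance decrease -/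

section UniformConvexity

variable {E : Type*} [NormedAddCommGroup E] [NormedSpace ℝ E]

theorem exists_midpoint_norm_le_sub_of_le [UniformConvexSpace E] {R η : ℝ} (hR : 0 < R)
    (hη : 0 < η) :
    ∃ δ, 0 < δ ∧ ∀ a b : E, ‖a‖ ≤ R → ‖b‖ ≤ ‖a‖ → η ≤ ‖a - b‖ →
      ‖(1 / 2 : ℝ) • (a + b)‖ ≤ ‖a‖ - δ := by
  obtain ⟨δ, hδ, h⟩ := exists_forall_closed_ball_dist_add_le_two_sub E (div_pos hη hR)
  -- After normalizing by `‖a‖`, the gain is `δ * ‖a‖ / 2`, and `‖a‖ ≥ η / 2`.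
  refine ⟨δ * η / 4, by positivity, fun a b ha hba hab => ?_⟩
  have hs : η / 2 ≤ ‖a‖ := by
    have := norm_sub_le a b
    linarith
  have hs0 : 0 < ‖a‖ := by linarith
  have key := h (x := ‖a‖⁻¹ • a) (y := ‖a‖⁻¹ • b)
    (by rw [norm_smul, norm_inv, norm_norm, inv_mul_cancel₀ hs0.ne'])
    (by
      rw [norm_smul, norm_inv, norm_norm, ← div_eq_inv_mul, div_le_one hs0]
      exact hba)
    (by
      rw [← smul_sub, norm_smul, norm_inv, norm_norm, ← div_eq_inv_mul]
      gcongr)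
  rw [← smul_add, norm_smul, norm_inv, norm_norm, ← div_eq_inv_mul, div_le_iff₀ hs0] at key
  rw [norm_smul]
  norm_num
  nlinarith

/-- Uniform convexity of the squared norm on a ball. -/
theorem exists_norm_sq_midpoint_le_sub [UniformConvexSpace E] {R η : ℝ} (hR : 0 < R)
    (hη : 0 < η) :
    ∃ c, 0 < c ∧ ∀ a b : E, ‖a‖ ≤ R → ‖b‖ ≤ R → η ≤ ‖a - b‖ →
      ‖(1 / 2 : ℝ) • (a + b)‖ ^ 2 ≤ (‖a‖ ^ 2 + ‖b‖ ^ 2) / 2 - c := by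
  obtain ⟨δ, hδ, h⟩ := exists_midpoint_norm_le_sub_of_le (E := E) hR hη
  have main : ∀ a b : E, ‖a‖ ≤ R → ‖b‖ ≤ ‖a‖ → η ≤ ‖a - b‖ →
      ‖(1 / 2 : ℝ) • (a + b)‖ ^ 2 ≤ (‖a‖ ^ 2 + ‖b‖ ^ 2) / 2 - δ ^ 2 / 4 := by
    intro a b ha hba hab
    have h1 := h a b ha hba hab
    have h2 : ‖(1 / 2 : ℝ) • (a + b)‖ ≤ (‖a‖ + ‖b‖) / 2 := by
      rw [norm_smul]
      norm_num
      linarith [norm_add_le a b]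
    have h0 := norm_nonneg ((1 / 2 : ℝ) • (a + b))
    set P := ‖(1 / 2 : ℝ) • (a + b)‖
    have hb := norm_nonneg b
    -- Either the norms differ by `δ` and strict convexity of the scalar square gives the gain, or
    -- the midpoint norm is `δ / 2` below the average norm.
    rcases le_total δ (‖a‖ - ‖b‖) with h3 | h3
    · nlinarith
    · have h4 : δ / 2 ≤ (‖a‖ + ‖b‖) / 2 - P := by linarith
      nlinarith [sq_nonneg (‖a‖ - ‖b‖)]
  refine ⟨δ ^ 2 / 4, by positivity, fun a b ha hb hab => ?_⟩
  rcases le_total ‖b‖ ‖a‖ with hba | hba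
  · exact main a b ha hba hab
  · rw [add_comm a b, add_comm (‖a‖ ^ 2)]
    exact main b a hb hba (by rwa [norm_sub_rev])

theorem norm_sq_midpoint_le (a b : E) :
    ‖(1 / 2 : ℝ) • (a + b)‖ ^ 2 ≤ (‖a‖ ^ 2 + ‖b‖ ^ 2) / 2 := by
  have h2 : ‖(1 / 2 : ℝ) • (a + b)‖ ≤ (‖a‖ + ‖b‖) / 2 := by
    rw [norm_smul]
    norm_num
    linarith [norm_add_le a b]
  nlinarith [sq_nonneg (‖a‖ - ‖b‖), norm_nonneg ((1 / 2 : ℝ) • (a + b))]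

/-- A form of the uniform convexity of the squared norm that can be integrated over `a` and `b`. -/
theorem exists_norm_sq_midpoint_le_sub_mul [UniformConvexSpace E] {R η : ℝ} (hR : 0 < R)
    (hη : 0 < η) :
    ∃ κ, 0 < κ ∧ ∀ a b : E, ‖a‖ ≤ R → ‖b‖ ≤ R →
      ‖(1 / 2 : ℝ) • (a + b)‖ ^ 2 ≤ (‖a‖ ^ 2 + ‖b‖ ^ 2) / 2 - κ * (‖a - b‖ - η) := by
  obtain ⟨c, hc, h⟩ := exists_norm_sq_midpoint_le_sub (E := E) hR hη
  refine ⟨c / (2 * R), by positivity, fun a b ha hb => ?_⟩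
  have hκ : 0 < c / (2 * R) := by positivity
  rcases le_total η ‖a - b‖ with hab | hab
  · refine (h a b ha hb hab).trans ?_
    have h1 : ‖a - b‖ - η ≤ 2 * R := by linarith [norm_sub_le a b]
    have h2 : c / (2 * R) * (‖a - b‖ - η) ≤ c / (2 * R) * (2 * R) := by gcongr
    rw [div_mul_cancel₀ c (by positivity)] at h2
    linarith
  · have := norm_sq_midpoint_le a b
    nlinarith

/-- Passing from a weighted family to the family of its midpoints lowers the variance by a fixed
amount, as long as all points stay away from the mean. -/
theorem sum_norm_sq_midpoint_sub_le {R η κ : ℝ}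
    (hκ : 0 < κ) (h : ∀ a b : E, ‖a‖ ≤ R → ‖b‖ ≤ R →
      ‖(1 / 2 : ℝ) • (a + b)‖ ^ 2 ≤ (‖a‖ ^ 2 + ‖b‖ ^ 2) / 2 - κ * (‖a - b‖ - η))
    {ι : Type*} [Fintype ι] (p : ι → ℝ) (z : ι → E) (w : E) (hp : ∀ i, 0 ≤ p i)
    (hp1 : ∑ i, p i = 1) (hw : ∑ i, p i • z i = w) (hz : ∀ i, ‖z i - w‖ ≤ R)
    (hfar : ∀ i, 2 * η ≤ ‖z i - w‖) :
    ∑ q : ι × ι, p q.1 * p q.2 * ‖(1 / 2 : ℝ) • (z q.1 + z q.2) - w‖ ^ 2 ≤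
      ∑ i, p i * ‖z i - w‖ ^ 2 - κ * η := by
  have h0 : ∑ j, p j • (z j - w) = 0 := by
    simp_rw [smul_sub]
    rw [Finset.sum_sub_distrib, hw, ← Finset.sum_smul, hp1, one_smul, sub_self]
  -- Since `w` is the mean, the average distance from `z i` to the family is at least `2 * η`; after
  -- subtracting `η`, a loss of `κ * η` remains.
  have hJ : ∀ i, ‖z i - w‖ ≤ ∑ j, p j * ‖(z i - w) - (z j - w)‖ := by
    intro i
    calc ‖z i - w‖ = ‖∑ j, p j • ((z i - w) - (z j - w))‖ := by
          simp_rw [smul_sub _ (z i - w)]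
          rw [Finset.sum_sub_distrib, h0, ← Finset.sum_smul, hp1, one_smul, sub_zero]
      _ ≤ ∑ j, ‖p j • ((z i - w) - (z j - w))‖ := norm_sum_le _ _
      _ = _ := by
          refine Finset.sum_congr rfl fun j _ => ?_
          rw [norm_smul, Real.norm_of_nonneg (hp j)]
  set V := ∑ i, p i * ‖z i - w‖ ^ 2 with hV
  have hi : ∀ i, ∑ j, p j * ‖(1 / 2 : ℝ) • (z i + z j) - w‖ ^ 2 ≤
      ‖z i - w‖ ^ 2 / 2 + V / 2 - κ * η := by
    intro i
    calc ∑ j, p j * ‖(1 / 2 : ℝ) • (z i + z j) - w‖ ^ 2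
        ≤ ∑ j, p j * ((‖z i - w‖ ^ 2 + ‖z j - w‖ ^ 2) / 2
            - κ * (‖(z i - w) - (z j - w)‖ - η)) := by
          refine Finset.sum_le_sum fun j _ => mul_le_mul_of_nonneg_left ?_ (hp j)
          rw [show (1 / 2 : ℝ) • (z i + z j) - w = (1 / 2 : ℝ) • ((z i - w) + (z j - w)) by module]
          exact h _ _ (hz i) (hz j)
      _ = (∑ j, p j) * (‖z i - w‖ ^ 2 / 2) + V / 2
            - κ * (∑ j, p j * ‖(z i - w) - (z j - w)‖) + (∑ j, p j) * (κ * η) := by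
          rw [hV, Finset.sum_mul, Finset.sum_mul, Finset.sum_div, Finset.mul_sum,
            ← Finset.sum_add_distrib, ← Finset.sum_sub_distrib, ← Finset.sum_add_distrib]
          refine Finset.sum_congr rfl fun j _ => ?_
          ring
      _ ≤ _ := by
          rw [hp1]
          have := (hfar i).trans (hJ i)
          nlinarith
  obtain ⟨D, hD⟩ : ∃ D, D = V / 2 - κ * η := ⟨_, rfl⟩
  simp_rw [add_sub_assoc, ← hD] at hi
  calc ∑ q : ι × ι, p q.1 * p q.2 * ‖(1 / 2 : ℝ) • (z q.1 + z q.2) - w‖ ^ 2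
      = ∑ i, p i * ∑ j, p j * ‖(1 / 2 : ℝ) • (z i + z j) - w‖ ^ 2 := by
        rw [Fintype.sum_prod_type]
        simp_rw [Finset.mul_sum, mul_assoc]
    _ ≤ ∑ i, p i * (‖z i - w‖ ^ 2 / 2 + D) :=
        Finset.sum_le_sum fun i _ => mul_le_mul_of_nonneg_left (hi i) (hp i)
    _ = V / 2 + (∑ i, p i) * D := by
        rw [hV, Finset.sum_mul, Finset.sum_div, ← Finset.sum_add_distrib]
        refine Finset.sum_congr rfl fun j _ => ?_
        ring
    _ = V - κ * η := by
        rw [hp1, hD]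
        ring

end UniformConvexity

/-! ### Convex hulls of approximate fixed points -/

section ApproximateFixedPoints

variable {E : Type*} [NormedAddCommGroup E] [NormedSpace ℝ E] [UniformConvexSpace E]

/-- With `m` the midpoint, `S m - a` and `b - S m` have length at most about `‖a - b‖ / 2` and sum
to `b - a`. They differ by `2 • (S m - m)`, so if this were large, uniform convexity would make
their sum too short. -/
theorem exists_norm_midpoint_sub_le {C : Set E} (hC : Convex ℝ C) {R : ℝ} (hR : 0 < R)
    (hdiam : ∀ a ∈ C, ∀ b ∈ C, ‖a - b‖ ≤ R) {ε : ℝ} (hε : 0 < ε) :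
    ∃ δ, 0 < δ ∧ δ ≤ 1 ∧ ∀ S : E → E, (∀ a ∈ C, ∀ b ∈ C, ‖S a - S b‖ ≤ (1 + δ) * ‖a - b‖) →
      ∀ a ∈ C, ∀ b ∈ C, ‖a - S a‖ ≤ δ → ‖b - S b‖ ≤ δ →
        ‖(1 / 2 : ℝ) • (a + b) - S ((1 / 2 : ℝ) • (a + b))‖ ≤ ε := by
  obtain ⟨c, hc, h⟩ := exists_norm_sq_midpoint_le_sub (E := E) (R := 2 * R + 1) (η := 2 * ε)
    (by positivity) (by positivity)
  set K := (2 * R + 1) * (R + 1) with hK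
  have hK0 : 0 < K := by positivity
  refine ⟨min 1 (c / (4 * K)), by positivity, min_le_left _ _, fun S hS a ha b hb hSa hSb => ?_⟩
  set δ := min 1 (c / (4 * K)) with hδ
  have hδ0 : 0 < δ := by positivity
  have hδ1 : δ ≤ 1 := min_le_left _ _
  have hδc : δ * (4 * K) ≤ c := by
    rw [← le_div_iff₀ (by positivity)]
    exact min_le_right _ _
  set m := (1 / 2 : ℝ) • (a + b) with hm
  have hmC : m ∈ C := by
    rw [hm, smul_add]
    exact hC ha hb (by norm_num) (by norm_num) (by norm_num)
  have hab := hdiam a ha b hb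
  have hma : ‖m - a‖ = ‖a - b‖ / 2 := by
    rw [show m - a = (-(1 / 2) : ℝ) • (a - b) by rw [hm]; module, norm_smul]
    norm_num
    ring
  have hmb : ‖b - m‖ = ‖a - b‖ / 2 := by
    rw [show b - m = (-(1 / 2) : ℝ) • (a - b) by rw [hm]; module, norm_smul]
    norm_num
    ring
  have hr0 := norm_nonneg (a - b)
  have hp : ‖S m - a‖ ≤ ‖a - b‖ / 2 + δ * (R + 1) := by
    have h1 := norm_sub_le_norm_sub_add_norm_sub (S m) (S a) a
    have h2 := hS m hmC a ha
    rw [norm_sub_rev] at hSa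
    rw [hma] at h2
    nlinarith
  have hq : ‖b - S m‖ ≤ ‖a - b‖ / 2 + δ * (R + 1) := by
    have h1 := norm_sub_le_norm_sub_add_norm_sub b (S b) (S m)
    have h2 := hS b hb m hmC
    rw [hmb] at h2
    nlinarith
  by_contra! hcon
  have key := h (S m - a) (b - S m) (by nlinarith) (by nlinarith) (by
    rw [show S m - a - (b - S m) = (-2 : ℝ) • (m - S m) by rw [hm]; module, norm_smul]
    norm_num
    exact hcon.le)
  rw [show (1 / 2 : ℝ) • (S m - a + (b - S m)) = (-(1 / 2) : ℝ) • (a - b) by module,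
    norm_smul] at key
  norm_num at key
  have e1 : ‖S m - a‖ ^ 2 ≤ (‖a - b‖ / 2 + δ * (R + 1)) ^ 2 := by gcongr
  have e2 : ‖b - S m‖ ^ 2 ≤ (‖a - b‖ / 2 + δ * (R + 1)) ^ 2 := by gcongr
  have e3 : ‖a - b‖ * (δ * (R + 1)) ≤ R * (δ * (R + 1)) := by gcongr
  have e4 : (δ * (R + 1)) * (δ * (R + 1)) ≤ (δ * (R + 1)) * (R + 1) := by
    gcongr
    nlinarith
  nlinarith

/-- Here `m` counts the variance in units of `κ * η`. While all points are far from the mean,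
passing to midpoints of pairs costs one unit and worsens the tolerance in a controlled way. Thus `δ`
depends on `m` but not on the number of points. -/
theorem exists_approx_fixed_near_mean {C : Set E} (hC : Convex ℝ C) {R : ℝ} (hR : 0 < R)
    (hdiam : ∀ a ∈ C, ∀ b ∈ C, ‖a - b‖ ≤ R) {η κ : ℝ} (hη : 0 < η) (hκ : 0 < κ)
    (h : ∀ a b : E, ‖a‖ ≤ R → ‖b‖ ≤ R →
      ‖(1 / 2 : ℝ) • (a + b)‖ ^ 2 ≤ (‖a‖ ^ 2 + ‖b‖ ^ 2) / 2 - κ * (‖a - b‖ - η))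
    {ε : ℝ} (hε : 0 < ε) (m : ℕ) :
    ∃ δ, 0 < δ ∧ δ ≤ 1 ∧ δ ≤ ε ∧
      ∀ S : E → E, (∀ a ∈ C, ∀ b ∈ C, ‖S a - S b‖ ≤ (1 + δ) * ‖a - b‖) →
      ∀ (ι : Type) (_ : Fintype ι) (p : ι → ℝ) (z : ι → E) (w : E), (∀ i, 0 ≤ p i) →
        ∑ i, p i = 1 → ∑ i, p i • z i = w → (∀ i, z i ∈ C) → (∀ i, ‖z i - S (z i)‖ ≤ δ) →
        ∑ i, p i * ‖z i - w‖ ^ 2 ≤ m * (κ * η) →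
        ∃ y ∈ C, ‖y - S y‖ ≤ ε ∧ ‖y - w‖ < 2 * η := by
  induction m with
  | zero =>
    refine ⟨min 1 ε, by positivity, min_le_left _ _, min_le_right _ _,
      fun S hS ι _ p z w hp hp1 hw hz hSz hV => ?_⟩
    by_contra! hcon
    have hfar : ∀ i, 2 * η ≤ ‖z i - w‖ := fun i =>
      hcon _ (hz i) ((hSz i).trans (min_le_right _ _))
    have : (∑ i, p i) * (2 * η) ^ 2 ≤ ∑ i, p i * ‖z i - w‖ ^ 2 := by
      rw [Finset.sum_mul]
      refine Finset.sum_le_sum fun i _ => mul_le_mul_of_nonneg_left ?_ (hp i)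
      have := hfar i
      gcongr
    rw [hp1] at this
    norm_num at hV
    nlinarith
  | succ m ih =>
    obtain ⟨δ', hδ', hδ'1, hδ'ε, ih⟩ := ih
    obtain ⟨δ₂, hδ₂, hδ₂1, hmid⟩ := exists_norm_midpoint_sub_le hC hR hdiam hδ'
    have mono : ∀ δ₀, min δ' δ₂ ≤ δ₀ → ∀ S : E → E,
        (∀ a ∈ C, ∀ b ∈ C, ‖S a - S b‖ ≤ (1 + min δ' δ₂) * ‖a - b‖) →
        ∀ a ∈ C, ∀ b ∈ C, ‖S a - S b‖ ≤ (1 + δ₀) * ‖a - b‖ := by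
      intro δ₀ h0 S hS a ha b hb
      refine (hS a ha b hb).trans ?_
      gcongr
    refine ⟨min δ' δ₂, by positivity, (min_le_left _ _).trans hδ'1,
      (min_le_left _ _).trans hδ'ε, fun S hS ι _ p z w hp hp1 hw hz hSz hV => ?_⟩
    by_contra! hcon
    have hfar : ∀ i, 2 * η ≤ ‖z i - w‖ := fun i =>
      hcon _ (hz i) ((hSz i).trans ((min_le_left _ _).trans hδ'ε))
    have hwC : w ∈ C := hw ▸ hC.sum_mem (fun i _ => hp i) hp1 (fun i _ => hz i)
    have hlow := sum_norm_sq_midpoint_sub_le hκ h p z w hp hp1 hw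
      (fun i => hdiam _ (hz i) _ hwC) hfar
    -- Product weights on pairs keep the mean `w`.
    obtain ⟨y, hyC, hy1, hy2⟩ := ih S (mono _ (min_le_left _ _) S hS) (ι × ι) inferInstance
      (fun q => p q.1 * p q.2) (fun q => (1 / 2 : ℝ) • (z q.1 + z q.2)) w
      (fun q => mul_nonneg (hp _) (hp _))
      (by rw [Fintype.sum_prod_type]; simp_rw [← Finset.mul_sum, hp1, mul_one, hp1])
      (by
        have e : ∀ i, ∑ j, (p i * p j) • (1 / 2 : ℝ) • (z i + z j) =
            (1 / 2 : ℝ) • p i • z i + (1 / 2 : ℝ) • p i • w := by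
          intro i
          calc ∑ j, (p i * p j) • (1 / 2 : ℝ) • (z i + z j)
              = (∑ j, p j) • (1 / 2 : ℝ) • p i • z i
                + ((1 / 2 : ℝ) * p i) • ∑ j, p j • z j := by
                rw [Finset.sum_smul, Finset.smul_sum, ← Finset.sum_add_distrib]
                refine Finset.sum_congr rfl fun j _ => by module
            _ = _ := by rw [hp1, hw, one_smul, mul_smul]
        rw [Fintype.sum_prod_type]
        simp_rw [e]
        rw [Finset.sum_add_distrib, ← Finset.smul_sum, ← Finset.smul_sum, hw,
          ← Finset.sum_smul, hp1]
        module)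
      (fun q => by
        rw [smul_add]
        exact hC (hz _) (hz _) (by norm_num) (by norm_num) (by norm_num))
      (fun q => hmid S (mono _ (min_le_right _ _) S hS) _ (hz _) _ (hz _)
        ((hSz _).trans (min_le_right _ _)) ((hSz _).trans (min_le_right _ _)))
      (by
        refine hlow.trans ?_
        push_cast at hV
        linarith)
    exact absurd hy2 (not_lt.mpr (hcon y hyC hy1))

/-- In a uniformly convex space, approximate fixed points of an almost nonexpansive map on a
bounded convex set `C` have a closed convex hull that consists of approximate fixed points,
uniformly over all such maps. -/
theorem exists_norm_sub_le_of_mem_closedConvexHull {C : Set E} (hC : Convex ℝ C)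
    (hCc : IsClosed C) (hCb : Bornology.IsBounded C) {ε : ℝ} (hε : 0 < ε) :
    ∃ δ, 0 < δ ∧ ∀ S : E → E, (∀ a ∈ C, ∀ b ∈ C, ‖S a - S b‖ ≤ (1 + δ) * ‖a - b‖) →
      ∀ w ∈ closedConvexHull ℝ {z | z ∈ C ∧ ‖z - S z‖ ≤ δ}, ‖w - S w‖ ≤ ε := by
  obtain ⟨R, hR, hdiam⟩ : ∃ R, 0 < R ∧ ∀ a ∈ C, ∀ b ∈ C, ‖a - b‖ ≤ R := by
    obtain ⟨R, hR⟩ := Metric.isBounded_iff.mp hCb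
    refine ⟨max R 1, by positivity, fun a ha b hb => ?_⟩
    rw [← dist_eq_norm]
    exact (hR ha hb).trans (le_max_left _ _)
  -- The point `y` found below is within `3 * η = ε / 4` of `w`, and `‖w - S w‖ ≤ 3 * ‖y - w‖ + ε /
  -- 4`.
  have hη : 0 < ε / 12 := by positivity
  obtain ⟨κ, hκ, h⟩ := exists_norm_sq_midpoint_le_sub_mul (E := E) hR hη
  obtain ⟨m, hm⟩ := exists_nat_ge (R ^ 2 / (κ * (ε / 12)))
  rw [div_le_iff₀ (by positivity)] at hm
  obtain ⟨δ, hδ, hδ1, -, hδS⟩ :=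
    exists_approx_fixed_near_mean hC hR hdiam hη hκ h (ε := ε / 4) (by positivity) m
  refine ⟨δ, hδ, fun S hS w hw => ?_⟩
  have hwC : w ∈ C := closedConvexHull_min (fun z hz => hz.1) hC hCc hw
  rw [closedConvexHull_eq_closure_convexHull] at hw
  obtain ⟨v, hv, hvw⟩ := Metric.mem_closure_iff.mp hw _ hη
  obtain ⟨ι, _, p, z, hp, hp1, hz, hpz⟩ := mem_convexHull_iff_exists_fintype.mp hv
  have hvC : v ∈ C := convexHull_min (fun z hz => hz.1) hC hv
  obtain ⟨y, hyC, hy1, hy2⟩ := hδS S hS ι _ p z v hp hp1 hpz (fun i => (hz i).1)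
    (fun i => (hz i).2) (by
      refine le_trans ?_ hm
      calc ∑ i, p i * ‖z i - v‖ ^ 2 ≤ ∑ i, p i * R ^ 2 := by
            refine Finset.sum_le_sum fun i _ => mul_le_mul_of_nonneg_left ?_ (hp i)
            have := hdiam _ (hz i).1 _ hvC
            gcongr
        _ = R ^ 2 := by rw [← Finset.sum_mul, hp1, one_mul])
  rw [dist_eq_norm] at hvw
  have h1 := norm_sub_le_norm_sub_add_norm_sub y v w
  rw [norm_sub_rev v w] at h1
  have h2 := norm_sub_le_norm_sub_add_norm_sub w y (S w)
  have h3 := norm_sub_le_norm_sub_add_norm_sub y (S y) (S w)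
  have h4 := hS y hyC w hwC
  have h5 : (1 + δ) * ‖y - w‖ ≤ 2 * ‖y - w‖ := by gcongr; linarith
  rw [norm_sub_rev w y] at h2
  linarith

end ApproximateFixedPoints

/-! ### Asymptotic centers and metric projections -/

section AsymptoticCenter

variable {E : Type*} [NormedAddCommGroup E] [NormedSpace ℝ E] [UniformConvexSpace E]

/-- The asymptotic center of a bounded sequence with respect to a closed convex set. -/
theorem exists_asymptotic_center [CompleteSpace E] {K : Set E} (hKne : K.Nonempty)
    (hKc : IsClosed K) (hK : Convex ℝ K) (y : ℕ → E) {B : ℝ} (hB : ∀ n, ‖y n‖ ≤ B) :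
    ∃ c ∈ K, ∃ r : ℝ, (∀ z ∈ K, ∀ ρ, (∀ᶠ n in atTop, ‖y n - z‖ ≤ ρ) → r ≤ ρ) ∧
      (∀ ρ > r, ∀ᶠ n in atTop, ‖y n - c‖ ≤ ρ) ∧
      ∀ η > 0, ∃ ρ > r, ∀ z ∈ K, (∀ᶠ n in atTop, ‖y n - z‖ ≤ ρ) → ‖z - c‖ ≤ η := by
  set A : Set ℝ := {ρ | ∃ z ∈ K, ∀ᶠ n in atTop, ‖y n - z‖ ≤ ρ} with hA
  have hA0 : ∀ ρ ∈ A, 0 ≤ ρ := by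
    rintro ρ ⟨z, -, hz⟩
    obtain ⟨n, hn⟩ := hz.exists
    exact (norm_nonneg _).trans hn
  have hAne : A.Nonempty := by
    obtain ⟨z, hz⟩ := hKne
    exact ⟨B + ‖z‖, z, hz, Eventually.of_forall fun n =>
      (norm_sub_le _ _).trans (by linarith [hB n])⟩
  have hAbdd : BddBelow A := ⟨0, hA0⟩
  set r := sInf A with hr
  have hr0 : 0 ≤ r := le_csInf hAne hA0
  have hne : ∀ ρ > r, ∃ z ∈ K, ∀ᶠ n in atTop, ‖y n - z‖ ≤ ρ := by
    intro ρ hρ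
    obtain ⟨σ, ⟨z, hzK, hz⟩, hσ⟩ := exists_lt_of_csInf_lt hAne hρ
    exact ⟨z, hzK, hz.mono fun n hn => hn.trans hσ.le⟩
  -- Two almost optimal centers are close, as otherwise their midpoint would beat the infimum `r`.
  have hsmall : ∀ η > 0, ∃ ρ > r, ∀ a ∈ K, ∀ b ∈ K, (∀ᶠ n in atTop, ‖y n - a‖ ≤ ρ) →
      (∀ᶠ n in atTop, ‖y n - b‖ ≤ ρ) → ‖a - b‖ < η := by
    intro η hη
    obtain ⟨c, hc, h⟩ := exists_norm_sq_midpoint_le_sub (E := E) (R := r + 1)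
      (by positivity) hη
    have hd : 0 < min 1 (c / (4 * (r + 1))) := by positivity
    set d := min 1 (c / (4 * (r + 1))) with hdef
    have hd1 : d ≤ 1 := min_le_left _ _
    have hdc : d * (4 * (r + 1)) ≤ c := by
      rw [← le_div_iff₀ (by positivity)]
      exact min_le_right _ _
    refine ⟨r + d, by linarith, fun a ha b hb hya hyb => ?_⟩
    by_contra! hab
    have hm : (1 / 2 : ℝ) • (a + b) ∈ K := by
      rw [smul_add]
      exact hK ha hb (by norm_num) (by norm_num) (by norm_num)
    have hsq : ∀ᶠ n in atTop, ‖y n - (1 / 2 : ℝ) • (a + b)‖ ≤ √((r + d) ^ 2 - c) := by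
      filter_upwards [hya, hyb] with n h1 h2
      refine Real.le_sqrt_of_sq_le ?_
      have := h (y n - a) (y n - b) (by linarith) (by linarith)
        (by rwa [sub_sub_sub_cancel_left, norm_sub_rev])
      rw [show (1 / 2 : ℝ) • (y n - a + (y n - b)) = y n - (1 / 2 : ℝ) • (a + b) by module]
        at this
      have e1 : ‖y n - a‖ ^ 2 ≤ (r + d) ^ 2 := by gcongr
      have e2 : ‖y n - b‖ ^ 2 ≤ (r + d) ^ 2 := by gcongr
      linarith
    have h1 : r ≤ √((r + d) ^ 2 - c) := csInf_le hAbdd ⟨_, hm, hsq⟩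
    -- A negative radicand gives the root the value `0`, which forces `r = 0`; a single index `n`
    -- then yields the contradiction.
    have h2 : √((r + d) ^ 2 - c) ^ 2 < r ^ 2 ∨ √((r + d) ^ 2 - c) = 0 := by
      rcases le_total ((r + d) ^ 2 - c) 0 with h0 | h0
      · exact Or.inr (Real.sqrt_eq_zero_of_nonpos h0)
      · left
        rw [Real.sq_sqrt h0]
        nlinarith
    rcases h2 with h2 | h2
    · nlinarith
    · have hr00 : r = 0 := by linarith
      have hn := (hya.and hyb).exists
      obtain ⟨n, h3, h4⟩ := hn
      have := h (y n - a) (y n - b) (by linarith) (by linarith)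
        (by rwa [sub_sub_sub_cancel_left, norm_sub_rev])
      have e1 : ‖y n - a‖ ^ 2 ≤ (r + d) ^ 2 := by gcongr
      have e2 : ‖y n - b‖ ^ 2 ≤ (r + d) ^ 2 := by gcongr
      rw [hr00] at e1 e2 hdc
      nlinarith [sq_nonneg ‖(1 / 2 : ℝ) • (y n - a + (y n - b))‖]
  have hpos : ∀ n : ℕ, r < r + 1 / ((n : ℝ) + 1) := fun n => by
    have : (0 : ℝ) < 1 / ((n : ℝ) + 1) := by positivity
    linarith
  choose a haK ha using fun n : ℕ => hne (r + 1 / ((n : ℝ) + 1)) (hpos n)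
  have hev : ∀ ρ > r, ∀ᶠ k in atTop, ∀ᶠ n in atTop, ‖y n - a k‖ ≤ ρ := by
    intro ρ hρ
    have ht : Tendsto (fun n : ℕ => r + 1 / ((n : ℝ) + 1)) atTop (𝓝 r) := by
      simpa using tendsto_one_div_add_atTop_nhds_zero_nat.const_add r
    filter_upwards [ht.eventually_lt_const hρ] with k hk
    exact (ha k).mono fun n hn => hn.trans hk.le
  have hcauchy : CauchySeq a := by
    rw [Metric.cauchySeq_iff]
    intro η hη
    obtain ⟨ρ, hρ, h⟩ := hsmall η hη
    obtain ⟨N, hN⟩ := eventually_atTop.mp (hev ρ hρ)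
    refine ⟨N, fun m hm n hn => ?_⟩
    rw [dist_eq_norm]
    exact h _ (haK m) _ (haK n) (hN m hm) (hN n hn)
  obtain ⟨c, hc⟩ := cauchySeq_tendsto_of_complete hcauchy
  have hcK : c ∈ K := hKc.mem_of_tendsto hc (Eventually.of_forall haK)
  refine ⟨c, hcK, r, fun z hz ρ hρ => csInf_le hAbdd ⟨z, hz, hρ⟩, fun ρ hρ => ?_,
    fun η hη => ?_⟩
  · have hc' := Metric.tendsto_atTop'.mp hc ((ρ - r) / 2) (by linarith)
    obtain ⟨N, hN⟩ := hc'
    obtain ⟨k, hk1, hk2⟩ :=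
      ((hev (r + (ρ - r) / 2) (by linarith)).and (eventually_gt_atTop N)).exists
    have hk3 := hN k hk2
    rw [dist_eq_norm] at hk3
    filter_upwards [hk1] with n hn
    have := norm_sub_le_norm_sub_add_norm_sub (y n) (a k) c
    linarith
  · obtain ⟨ρ, hρ, h⟩ := hsmall η hη
    refine ⟨ρ, hρ, fun z hz hyz => ?_⟩
    refine le_of_tendsto ((tendsto_const_nhds.sub hc).norm) ?_
    filter_upwards [hev ρ hρ] with k hk
    exact (h z hz _ (haK k) hyz hk).le

/-- The projection of `x` is the asymptotic center of the constant sequence `x`. -/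
theorem existsUnique_isMetricProj [CompleteSpace E] {K : Set E} (hKne : K.Nonempty)
    (hKc : IsClosed K) (hK : Convex ℝ K) (x : E) : ∃! u, IsMetricProj K x u := by
  obtain ⟨c, hcK, r, hr, hc, hu⟩ :=
    exists_asymptotic_center hKne hKc hK (fun _ => x) (B := ‖x‖) (fun _ => le_rfl)
  simp only [eventually_const] at hr hc hu
  refine ⟨c, ⟨hcK, fun z hz => ?_⟩, fun u hu' => ?_⟩
  · rw [norm_sub_rev c, norm_sub_rev z]
    exact (le_of_forall_gt_imp_ge_of_dense hc).trans (hr z hz _ le_rfl)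
  · rw [← sub_eq_zero, ← norm_le_zero_iff]
    refine le_of_forall_gt_imp_ge_of_dense fun η hη => ?_
    obtain ⟨ρ, hρ, h⟩ := hu η hη
    refine h u hu'.1 ?_
    have := hu'.2 c hcK
    rw [norm_sub_rev, norm_sub_rev c] at this
    exact this.trans (hc ρ hρ)

end AsymptoticCenter

/-! ### Fixed points of asymptotically nonexpansive maps -/

section FixedPoints

theorem iterate_eq_of_mem_fixedSet {E : Type*} {C : Set E} {T : E → E} {z : E} (hz : z ∈ fixedSet C T) (n : ℕ) : T^[n] z = z :=
  Function.iterate_fixed hz.2 n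

variable {E : Type*} [NormedAddCommGroup E] {C : Set E} {T : E → E}

theorem IsAsympNonexpansive.mem_fixedSet_of_tendsto (hT : IsAsympNonexpansive C T) {w : E}
    (hw : w ∈ C) (hlim : Tendsto (fun n => T^[n] w) atTop (𝓝 w)) : w ∈ fixedSet C T := by
  obtain ⟨hmap, k, -, -, hk⟩ := hT
  refine ⟨hw, ?_⟩
  have h1 : Tendsto (fun n => T^[n + 1] w) atTop (𝓝 w) :=
    (tendsto_add_atTop_iff_nat (f := fun n => T^[n] w) 1).mpr hlim
  refine tendsto_nhds_unique ?_ h1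
  rw [tendsto_iff_norm_sub_tendsto_zero] at hlim ⊢
  refine squeeze_zero (fun _ => norm_nonneg _) (fun n => ?_)
    (by simpa using hlim.const_mul (k 1))
  rw [Function.iterate_succ_apply']
  simpa using hk 1 le_rfl _ (hmap.iterate n hw) _ hw

variable [NormedSpace ℝ E] [UniformConvexSpace E]

theorem IsAsympNonexpansive.mem_fixedSet_of_mem_closedConvexHull (hT : IsAsympNonexpansive C T)
    (hC : Convex ℝ C) (hCc : IsClosed C) (hCb : Bornology.IsBounded C) {w : E} (hwC : w ∈ C)
    (hw : ∀ δ > 0, ∀ᶠ n in atTop, w ∈ closedConvexHull ℝ {z | z ∈ C ∧ ‖z - T^[n] z‖ ≤ δ}) :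
    w ∈ fixedSet C T := by
  refine hT.mem_fixedSet_of_tendsto hwC ?_
  obtain ⟨hmap, k, -, hk1, hk⟩ := hT
  rw [Metric.tendsto_nhds]
  intro ε hε
  obtain ⟨δ, hδ, h⟩ := exists_norm_sub_le_of_mem_closedConvexHull hC hCc hCb (half_pos hε)
  filter_upwards [hw δ hδ, hk1.eventually_lt_const (show (1 : ℝ) < 1 + δ by linarith),
    eventually_ge_atTop 1] with n h1 h2 h3
  rw [dist_comm, dist_eq_norm]
  have := h T^[n] (fun a ha b hb => (hk n h3 a ha b hb).trans (by gcongr)) w h1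
  linarith

theorem IsAsympNonexpansive.closedConvexHull_fixedSet (hT : IsAsympNonexpansive C T)
    (hC : Convex ℝ C) (hCc : IsClosed C) (hCb : Bornology.IsBounded C) :
    closedConvexHull ℝ (fixedSet C T) = fixedSet C T := by
  refine Subset.antisymm (fun w hw => ?_) subset_closedConvexHull
  refine hT.mem_fixedSet_of_mem_closedConvexHull hC hCc hCb
    (closedConvexHull_min (fun z hz => hz.1) hC hCc hw) fun δ hδ => Eventually.of_forall fun n => ?_
  have hsub : fixedSet C T ⊆ {z | z ∈ C ∧ ‖z - T^[n] z‖ ≤ δ} := by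
    refine fun z hz => ⟨hz.1, ?_⟩
    rw [iterate_eq_of_mem_fixedSet hz, sub_self, norm_zero]
    exact hδ.le
  exact (closedConvexHull ℝ).monotone hsub hw

/-- Let `c` be the asymptotic center of an orbit. Since `k m` tends to `1`, `T^[m] c` is almost as
good a center as `c`, hence close to `c` for large `m`. -/
theorem IsAsympNonexpansive.fixedSet_nonempty [CompleteSpace E] (hT : IsAsympNonexpansive C T)
    (hCne : C.Nonempty) (hC : Convex ℝ C) (hCc : IsClosed C) (hCb : Bornology.IsBounded C) :
    (fixedSet C T).Nonempty := by
  obtain ⟨y, hy⟩ := hCne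
  obtain ⟨B, hB⟩ := hCb.exists_norm_le
  obtain ⟨c, hcC, r, hr, hc, hu⟩ := exists_asymptotic_center ⟨y, hy⟩ hCc hC (fun n => T^[n] y)
    (B := B) (fun n => hB _ (hT.1.iterate n hy))
  refine ⟨c, hT.mem_fixedSet_of_tendsto hcC ?_⟩
  obtain ⟨hmap, k, hk0, hk1, hk⟩ := hT
  rw [Metric.tendsto_nhds]
  intro ε hε
  obtain ⟨ρ, hρ, h⟩ := hu (ε / 2) (by positivity)
  have hσ : ∀ᶠ m in atTop, k m * ((r + ρ) / 2) < ρ := by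
    have := hk1.mul_const ((r + ρ) / 2)
    rw [one_mul] at this
    exact this.eventually_lt_const (by linarith)
  filter_upwards [hσ, eventually_ge_atTop 1] with m hm hm1
  rw [dist_eq_norm]
  refine (h _ (hmap.iterate m hcC) ?_).trans_lt (by linarith)
  obtain ⟨N, hN⟩ := eventually_atTop.mp (hc ((r + ρ) / 2) (by linarith))
  filter_upwards [eventually_ge_atTop (N + m)] with n hn
  obtain ⟨j, rfl⟩ := Nat.exists_eq_add_of_le' (show m ≤ n by omega)
  rw [add_comm j m, Function.iterate_add_apply]
  refine (hk m hm1 _ (hmap.iterate j hy) _ hcC).trans (le_trans ?_ hm.le)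
  have := hN j (by omega)
  have := hk0 m
  gcongr

end FixedPoints

/-! ### The hybrid scheme and its convergence -/

section Scheme

open Classical in
/-- A metric projection of `x` onto `K`, if there is one. -/
noncomputable def metricProj {E : Type*} [NormedAddCommGroup E] (K : Set E) (x : E) : E :=
  if h : ∃ u, IsMetricProj K x u then h.choose else x

theorem isMetricProj_metricProj {E : Type*} [NormedAddCommGroup E] {K : Set E} {x : E} (h : ∃ u, IsMetricProj K x u) :
    IsMetricProj K x (metricProj K x) := by
  rw [metricProj, dif_pos h]
  exact h.choose_spec

variable {E : Type*} [NormedAddCommGroup E] [NormedSpace ℝ E]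

theorem IsSmoothSpace.exists_tendsto (hE : IsSmoothSpace E) {a : E} (ha : a ≠ 0) (b : E) :
    ∃ l : ℝ, Tendsto (fun s : ℝ => (‖a + s • b‖ - ‖a‖) / s) (𝓝[≠] 0) (𝓝 l) := by
  rcases eq_or_ne b 0 with rfl | hb
  · exact ⟨0, by simp⟩
  have ha' : 0 < ‖a‖ := norm_pos_iff.mpr ha
  have hb' : 0 < ‖b‖ := norm_pos_iff.mpr hb
  obtain ⟨l, hl⟩ := hE (‖a‖⁻¹ • a) (‖b‖⁻¹ • b) (norm_smul_inv_norm ha) (norm_smul_inv_norm hb)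
  have hq : 0 < ‖b‖ / ‖a‖ := by positivity
  have hs : Tendsto (fun s : ℝ => ‖b‖ / ‖a‖ * s) (𝓝[≠] 0) (𝓝[≠] 0) := by
    refine tendsto_nhdsWithin_iff.mpr ⟨?_, ?_⟩
    · have : Tendsto (fun s : ℝ => ‖b‖ / ‖a‖ * s) (𝓝 0) (𝓝 (‖b‖ / ‖a‖ * 0)) :=
        tendsto_id.const_mul _
      rw [mul_zero] at this
      exact this.mono_left nhdsWithin_le_nhds
    · filter_upwards [self_mem_nhdsWithin] with s hs
      exact mul_ne_zero hq.ne' hs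
  refine ⟨‖b‖ * l, ((hl.comp hs).const_mul ‖b‖).congr' ?_⟩
  filter_upwards [self_mem_nhdsWithin] with s hs
  have hs0 : s ≠ 0 := hs
  have e : ‖a‖⁻¹ • a + (‖b‖ / ‖a‖ * s) • ‖b‖⁻¹ • b = ‖a‖⁻¹ • (a + s • b) := by
    rw [smul_smul, smul_add, smul_smul]
    congr 2
    field_simp
  simp only [Function.comp_apply]
  rw [e, norm_smul, norm_smul, norm_inv, norm_norm]
  field_simp

/-- Variational inequality for a metric projection onto a convex set in a smooth space. -/
theorem IsMetricProj.dualityMap_nonneg (hE : IsSmoothSpace E) {K : Set E} (hK : Convex ℝ K)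
    {x v z : E} (hv : IsMetricProj K x v) (hz : z ∈ K) {f : StrongDual ℝ E}
    (hf : f ∈ dualityMap (x - v)) : 0 ≤ f (v - z) := by
  obtain ⟨hf1, hf2⟩ := hf
  have hfn : ‖f‖ = ‖x - v‖ := by
    rwa [sq_eq_sq₀ (norm_nonneg _) (norm_nonneg _)] at hf2
  rcases eq_or_ne (x - v) 0 with h0 | h0
  · rw [h0, norm_zero, norm_eq_zero] at hfn
    simp [hfn]
  have ha : 0 < ‖x - v‖ := norm_pos_iff.mpr h0
  -- Minimality of `v` bounds quotients with `s > 0` below by `0`; the subgradient inequality bounds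
  -- those with `s < 0` above by `f (v - z) / ‖x - v‖`. Smoothness makes both one-sided limits equal
  -- `l`.
  obtain ⟨l, hl⟩ := hE.exists_tendsto h0 (v - z)
  have hsub : ∀ s : ℝ, s * f (v - z) ≤ ‖x - v‖ * (‖x - v + s • (v - z)‖ - ‖x - v‖) := by
    intro s
    have h1 := (le_abs_self _).trans (f.le_opNorm (x - v + s • (v - z)))
    rw [map_add, map_smul, hf1, hfn, smul_eq_mul] at h1
    linarith
  have hl0 : 0 ≤ l := by
    refine ge_of_tendsto (hl.mono_left (nhdsWithin_mono 0 fun s (hs : s ∈ Ioi 0) => ne_of_gt hs)) ?_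
    filter_upwards [Ioo_mem_nhdsGT (zero_lt_one (α := ℝ))] with s hs
    have h1 := hv.2 _ (hK hv.1 hz (by linarith [hs.2] : 0 ≤ 1 - s) hs.1.le (by ring))
    rw [norm_sub_rev, norm_sub_rev _ x,
      show x - ((1 - s) • v + s • z) = x - v + s • (v - z) by module] at h1
    exact div_nonneg (by linarith) hs.1.le
  have hl1 : l ≤ f (v - z) / ‖x - v‖ := by
    refine le_of_tendsto (hl.mono_left (nhdsWithin_mono 0 fun s (hs : s ∈ Iio 0) => ne_of_lt hs)) ?_
    filter_upwards [self_mem_nhdsWithin] with s hs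
    rw [div_le_iff_of_neg hs, div_mul_eq_mul_div, div_le_iff₀ ha]
    linarith [hsub s]
  have := hl0.trans hl1
  rwa [le_div_iff₀ ha, zero_mul] at this

/-- What the steps of the hybrid scheme preserve: both sets are closed convex subsets of `C` that
contain the set of fixed points. -/
structure IsAdmissiblePair (C : Set E) (T : E → E) (P Q : Set E) : Prop where
  isClosed_left : IsClosed P
  isClosed_right : IsClosed Q
  convex_left : Convex ℝ P
  convex_right : Convex ℝ Q
  left_subset : P ⊆ C
  fixedSet_subset_left : fixedSet C T ⊆ P
  fixedSet_subset_right : fixedSet C T ⊆ Q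

theorem IsAdmissiblePair.step (hE : IsSmoothSpace E) {C P Q : Set E} {T : E → E} {x v : E}
    (h : IsAdmissiblePair C T P Q) (hv : IsMetricProj (P ∩ Q) x v) (n : ℕ) {τ : ℝ} (hτ : 0 ≤ τ) :
    IsAdmissiblePair C T (closedConvexHull ℝ {z | z ∈ P ∧ ‖z - T^[n] z‖ ≤ τ})
      {z | z ∈ Q ∧ ∀ f ∈ dualityMap (x - v), 0 ≤ f (v - z)} where
  isClosed_left := isClosed_closedConvexHull
  isClosed_right := by
    have : {z | z ∈ Q ∧ ∀ f ∈ dualityMap (x - v), 0 ≤ f (v - z)} =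
        Q ∩ ⋂ f ∈ dualityMap (x - v), {z | 0 ≤ f (v - z)} := by
      ext z
      simp
    rw [this]
    exact h.isClosed_right.inter <| isClosed_biInter fun f _ =>
      isClosed_le continuous_const (f.continuous.comp (continuous_const.sub continuous_id))
  convex_left := convex_closedConvexHull
  convex_right := by
    intro a ha b hb s t hs ht hst
    refine ⟨h.convex_right ha.1 hb.1 hs ht hst, fun f hf => ?_⟩
    have e : v - (s • a + t • b) = s • (v - a) + t • (v - b) := by
      rw [show t = 1 - s by linarith]
      module
    rw [e, map_add, map_smul, map_smul, smul_eq_mul, smul_eq_mul]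
    exact add_nonneg (mul_nonneg hs (ha.2 f hf)) (mul_nonneg ht (hb.2 f hf))
  left_subset := (closedConvexHull_min (fun z hz => hz.1) h.convex_left h.isClosed_left).trans
    h.left_subset
  fixedSet_subset_left := fun z hz => subset_closedConvexHull ⟨h.fixedSet_subset_left hz, by
    rw [iterate_eq_of_mem_fixedSet hz, sub_self, norm_zero]
    exact hτ⟩
  fixedSet_subset_right := fun z hz => ⟨h.fixedSet_subset_right hz, fun f hf =>
    hv.dualityMap_nonneg hE (h.convex_left.inter h.convex_right)
      ⟨h.fixedSet_subset_left hz, h.fixedSet_subset_right hz⟩ hf⟩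

variable {C : Set E} {T : E → E} {t : ℕ → ℝ} {x : E} {Cs Ds : ℕ → Set E} {xs : ℕ → E}

theorem IsHybridScheme.isMetricProj (hS : IsHybridScheme C T t x Cs Ds xs) (hx : x ∈ C) (n : ℕ) :
    IsMetricProj (Cs n ∩ Ds n) x (xs (n + 1)) := by
  rcases Nat.eq_zero_or_pos n with rfl | hn
  · rw [zero_add, hS.x_one, hS.C_zero, hS.D_zero, inter_self]
    exact ⟨hx, fun y _ => by simp⟩
  · exact hS.x_succ n hn

theorem IsHybridScheme.isAdmissiblePair (hE : IsSmoothSpace E) (hC : Convex ℝ C)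
    (hCc : IsClosed C) (ht : ∀ n, 1 ≤ n → 0 ≤ t n) (hS : IsHybridScheme C T t x Cs Ds xs)
    (hx : x ∈ C) (n : ℕ) : IsAdmissiblePair C T (Cs n) (Ds n) := by
  induction n with
  | zero =>
    rw [hS.C_zero, hS.D_zero]
    exact ⟨hCc, hCc, hC, hC, Subset.rfl, fun z hz => hz.1, fun z hz => hz.1⟩
  | succ n ih =>
    rw [hS.C_succ, hS.D_succ]
    exact ih.step hE (hS.isMetricProj hx n) (n + 1)
      (mul_nonneg (ht _ (by omega)) (norm_nonneg _))

/-- The triples `(Cs n, Ds n, xs (n + 1))` of the hybrid scheme. -/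
noncomputable def hybridTriple (C : Set E) (T : E → E) (t : ℕ → ℝ) (x : E) :
    ℕ → Set E × Set E × E
  | 0 => (C, C, x)
  | n + 1 =>
    let s := hybridTriple C T t x n
    let P := closedConvexHull ℝ
      {z | z ∈ s.1 ∧ ‖z - T^[n + 1] z‖ ≤ t (n + 1) * ‖s.2.2 - T^[n + 1] s.2.2‖}
    let Q := {z | z ∈ s.2.1 ∧ ∀ f ∈ dualityMap (x - s.2.2), 0 ≤ f (s.2.2 - z)}
    (P, Q, metricProj (P ∩ Q) x)

variable [UniformConvexSpace E] [CompleteSpace E]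

theorem IsAdmissiblePair.existsUnique_isMetricProj {P Q : Set E} (h : IsAdmissiblePair C T P Q)
    (hF : (fixedSet C T).Nonempty) (x : E) : ∃! u, IsMetricProj (P ∩ Q) x u :=
  _root_.existsUnique_isMetricProj
    (hF.mono (subset_inter h.fixedSet_subset_left h.fixedSet_subset_right))
    (h.isClosed_left.inter h.isClosed_right) (h.convex_left.inter h.convex_right) x

/-- Triple `n` stores $x_{n+1}$, hence the shift `n - 1`, which at `n = 0` only affects the unused
value. Admissibility and projection must be proved together, as each step needs both. -/
theorem isHybridScheme_hybridTriple (hE : IsSmoothSpace E) (hC : Convex ℝ C) (hCc : IsClosed C)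
    (hF : (fixedSet C T).Nonempty) (ht : ∀ n, 1 ≤ n → 0 ≤ t n) (hx : x ∈ C) :
    IsHybridScheme C T t x (fun n => (hybridTriple C T t x n).1)
      (fun n => (hybridTriple C T t x n).2.1) (fun n => (hybridTriple C T t x (n - 1)).2.2) := by
  have key : ∀ n, IsAdmissiblePair C T (hybridTriple C T t x n).1 (hybridTriple C T t x n).2.1 ∧
      IsMetricProj ((hybridTriple C T t x n).1 ∩ (hybridTriple C T t x n).2.1) x
        (hybridTriple C T t x n).2.2 := by
    intro n
    induction n with
    | zero =>
      refine ⟨⟨hCc, hCc, hC, hC, Subset.rfl, fun z hz => hz.1, fun z hz => hz.1⟩, ⟨hx, hx⟩, ?_⟩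
      intro y _
      simp [hybridTriple]
    | succ n ih =>
      have := ih.1.step hE ih.2 (n + 1)
        (mul_nonneg (ht (n + 1) (by omega))
          (norm_nonneg ((hybridTriple C T t x n).2.2 - T^[n + 1] (hybridTriple C T t x n).2.2)))
      exact ⟨this, isMetricProj_metricProj (this.existsUnique_isMetricProj hF x).exists⟩
  exact ⟨rfl, rfl, rfl, fun n => rfl, fun n => rfl, fun n _ => (key n).2⟩

theorem antitone_isMetricProj_tendsto {K : ℕ → Set E} (hanti : Antitone K)
    (hconv : ∀ n, Convex ℝ (K n)) (hclosed : ∀ n, IsClosed (K n)) {x u : E} {v : ℕ → E}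
    (hv : ∀ n, IsMetricProj (K n) x (v n)) (hu : ∀ n, u ∈ K n) :
    ∃ w, Tendsto v atTop (𝓝 w) ∧ (∀ n, w ∈ K n) ∧ ‖w - x‖ ≤ ‖u - x‖ := by
  have hub : ∀ n, ‖v n - x‖ ≤ ‖u - x‖ := fun n => (hv n).2 u (hu n)
  have hmono : Monotone fun n => ‖v n - x‖ := fun m n hmn => (hv m).2 _ (hanti hmn (hv n).1)
  have hd : Tendsto (fun n => ‖v n - x‖) atTop (𝓝 (⨆ n, ‖v n - x‖)) :=
    tendsto_atTop_ciSup hmono ⟨_, forall_mem_range.mpr hub⟩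
  set d := ⨆ n, ‖v n - x‖
  have hdle : ∀ n, ‖v n - x‖ ≤ d := fun n => hmono.ge_of_tendsto hd n
  have hcauchy : CauchySeq v := by
    rw [Metric.cauchySeq_iff']
    intro η hη
    obtain ⟨c, hc, h⟩ := exists_norm_sq_midpoint_le_sub (E := E) (R := ‖u - x‖ + 1)
      (by positivity) hη
    -- If `v n` were far from `v N`, their midpoint, which lies in `K N`, would be closer to `x`
    -- than `v N`.
    obtain ⟨N, hN⟩ := ((hd.pow 2).eventually_const_lt
      (show d ^ 2 - c < d ^ 2 by linarith)).exists
    refine ⟨N, fun n hn => ?_⟩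
    by_contra! hcon
    rw [dist_eq_norm] at hcon
    have h1 := h (v n - x) (v N - x) (by linarith [hub n]) (by linarith [hub N])
      (by rwa [sub_sub_sub_cancel_right])
    have hm : (1 / 2 : ℝ) • (v n + v N) ∈ K N := by
      rw [smul_add]
      exact hconv N (hanti hn (hv n).1) (hv N).1 (by norm_num) (by norm_num) (by norm_num)
    have h2 := (hv N).2 _ hm
    rw [show (1 / 2 : ℝ) • (v n - x + (v N - x)) = (1 / 2 : ℝ) • (v n + v N) - x by module] at h1
    have h3 : ‖v N - x‖ ^ 2 ≤ ‖(1 / 2 : ℝ) • (v n + v N) - x‖ ^ 2 := by gcongr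
    have h4 : ‖v n - x‖ ^ 2 ≤ d ^ 2 := by
      have := hdle n
      gcongr
    linarith
  obtain ⟨w, hw⟩ := cauchySeq_tendsto_of_complete hcauchy
  refine ⟨w, hw, fun n => (hclosed n).mem_of_tendsto hw ?_, ?_⟩
  · filter_upwards [eventually_ge_atTop n] with m hm
    exact hanti hm (hv m).1
  · exact le_of_tendsto (hw.sub_const x).norm (Eventually.of_forall hub)

theorem IsHybridScheme.tendsto (hE : IsSmoothSpace E) (hC : Convex ℝ C) (hCc : IsClosed C)
    (hCb : Bornology.IsBounded C) (hT : IsAsympNonexpansive C T) (ht : ∀ n, 1 ≤ n → 0 ≤ t n)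
    (ht0 : Tendsto t atTop (𝓝 0)) (hx : x ∈ C) (hS : IsHybridScheme C T t x Cs Ds xs) {u : E}
    (hu : IsMetricProj (fixedSet C T) x u) : Tendsto xs atTop (𝓝 u) := by
  have hadm := hS.isAdmissiblePair hE hC hCc ht hx
  have hanti : Antitone fun n => Cs n ∩ Ds n := by
    refine antitone_nat_of_succ_le fun n => inter_subset_inter ?_ ?_
    · rw [hS.C_succ]
      exact closedConvexHull_min (fun z hz => hz.1) (hadm n).convex_left (hadm n).isClosed_left
    · rw [hS.D_succ]
      exact fun z hz => hz.1
  obtain ⟨w, hw, hwK, hwx⟩ := antitone_isMetricProj_tendsto hanti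
    (fun n => (hadm n).convex_left.inter (hadm n).convex_right)
    (fun n => (hadm n).isClosed_left.inter (hadm n).isClosed_right) (hS.isMetricProj hx)
    (fun n => ⟨(hadm n).fixedSet_subset_left hu.1, (hadm n).fixedSet_subset_right hu.1⟩)
  obtain ⟨B, hB⟩ := Metric.isBounded_iff.mp hCb
  have hwF : w ∈ fixedSet C T := by
    refine hT.mem_fixedSet_of_mem_closedConvexHull hC hCc hCb ((hadm 0).left_subset (hwK 0).1)
      fun δ hδ => ?_
    -- The bound `B` on distances in `C` controls $\|x_n-T^nx_n\|$, so the tolerances in $C_n$ tend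
    -- to zero.
    have htB : Tendsto (fun n => t n * B) atTop (𝓝 0) := by simpa using ht0.mul_const B
    filter_upwards [htB.eventually_lt_const hδ, eventually_ge_atTop 1] with n hn hn1
    obtain ⟨m, rfl⟩ := Nat.exists_eq_add_of_le' hn1
    have hwC := (hwK (m + 1)).1
    rw [hS.C_succ] at hwC
    have hxC : xs (m + 1) ∈ C := (hadm m).left_subset (hS.isMetricProj hx m).1.1
    have hd := hB hxC (hT.1.iterate (m + 1) hxC)
    rw [dist_eq_norm] at hd
    have hsub : {z | z ∈ Cs m ∧
          ‖z - T^[m + 1] z‖ ≤ t (m + 1) * ‖xs (m + 1) - T^[m + 1] (xs (m + 1))‖} ⊆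
        {z | z ∈ C ∧ ‖z - T^[m + 1] z‖ ≤ δ} := fun z hz => ⟨(hadm m).left_subset hz.1,
      hz.2.trans ((mul_le_mul_of_nonneg_left hd (ht _ hn1)).trans hn.le)⟩
    exact (closedConvexHull ℝ).monotone hsub hwC
  have hF := hT.closedConvexHull_fixedSet hC hCc hCb
  have huniq := existsUnique_isMetricProj ⟨u, hu.1⟩ (hF ▸ isClosed_closedConvexHull)
    (hF ▸ convex_closedConvexHull) x
  rw [huniq.unique hu ⟨hwF, fun y hy => hwx.trans (hu.2 y hy)⟩]
  exact (tendsto_add_atTop_iff_nat 1).mp hw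

end Scheme

theorem theorem3p3 {E : Type*} [NormedAddCommGroup E] [NormedSpace ℝ E] [CompleteSpace E]
    [UniformConvexSpace E] (hE : IsSmoothSpace E)
    (C : Set E) (hCne : C.Nonempty) (hCb : Bornology.IsBounded C) (hCc : IsClosed C)
    (hCconv : Convex ℝ C)
    (T : E → E) (hT : IsAsympNonexpansive C T)
    (t : ℕ → ℝ) (ht : ∀ n, 1 ≤ n → 0 < t n ∧ t n < 1) (ht0 : Tendsto t atTop (𝓝 0))
    (x : E) (hx : x ∈ C) :
    -- the metric projection onto the set of fixed points is well defined
    (∀ z : E, ∃! u, IsMetricProj (fixedSet C T) z u) ∧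
    -- the scheme is well defined: it can be run, and every step is uniquely determined
    (∃ (Cs Ds : ℕ → Set E) (xs : ℕ → E), IsHybridScheme C T t x Cs Ds xs) ∧
    (∀ (Cs Ds : ℕ → Set E) (xs : ℕ → E), IsHybridScheme C T t x Cs Ds xs →
      ∀ n, 1 ≤ n → ∃! v, IsMetricProj (Cs n ∩ Ds n) x v) ∧
    -- strong convergence to the projection of `x` onto the set of fixed points
    (∀ (Cs Ds : ℕ → Set E) (xs : ℕ → E), IsHybridScheme C T t x Cs Ds xs →
      ∀ u, IsMetricProj (fixedSet C T) x u → Tendsto xs atTop (𝓝 u)) := by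
  have hF := hT.fixedSet_nonempty hCne hCconv hCc hCb
  have hcl := hT.closedConvexHull_fixedSet hCconv hCc hCb
  have ht' : ∀ n, 1 ≤ n → 0 ≤ t n := fun n hn => (ht n hn).1.le
  refine ⟨existsUnique_isMetricProj hF (hcl ▸ isClosed_closedConvexHull)
      (hcl ▸ convex_closedConvexHull),
    ⟨_, _, _, isHybridScheme_hybridTriple hE hCconv hCc hF ht' hx⟩,
    fun Cs Ds xs hS n _ =>
      (hS.isAdmissiblePair hE hCconv hCc ht' hx n).existsUnique_isMetricProj hF x,
    fun Cs Ds xs hS u hu => hS.tendsto hE hCconv hCc hCb hT ht' ht0 hx hu⟩
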